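/- Let $H$ be a (real or complex) Hilbert space and let $W=(W_j,w_j)_{j\in J}$ and $V=(V_i,v_i)_{i\in I}$ be families of closed subspaces of $H$ with weights $w_j,v_i>0$. Such a family $(W_j,w_j)$ is called - a *Bessel fusion sequence* with bound $B$ ($0<B<\infty$) if $\sum_j w_j^2\|\pi_{W_j}f\|^2\le B\|f\|^2$ for all $f\in H$, where $\pi_{W_j}$ is the orthogonal projection onto $W_j$; - a *fusion frame* with bounds $A,B$ ($0<A\le B<\infty$) if $A\|f\|^2\le\sum_j w_j^2\|\pi_{W_j}f\|^2\le B\|f\|^2$ for all $f\in H$; - a *fusion Riesz sequence* with bounds $A,B$ ($0<A\le B<\infty$) if $A\sum_{j\in F}\|f_j\|^2\le\|\sum_{j\in F}w_jf_j\|^2\le B\sum_{j\in F}\|f_j\|^2$ for all finite $F\subseteq J$ and all $f_j\in W_j$. Let $S_2(H)$ be the Hilbert space of Hilbert–Schmidt operators on $H$ with $\langle S,T\rangle=\operatorname{trace}(S^*T)$, let $W_j\otimes V_i$ be the space of Hilbert–Schmidt operators from $V_i$ to $W_j$, regarded as a (closed) subspace of $S_2(H)$ by identifying $U:V_i\to W_j$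 with $f\mapsto U\pi_{V_i}f$, and let $W\otimes V:=(W_j\otimes V_i,\,v_iw_j)_{(j,i)\in J\times I}$. 1. If $W$ and $V$ are Bessel fusion sequences (fusion frames, fusion Riesz sequences) with bounds $B_W$ and $B_V$ (respectively $A_W,B_W$ and $A_V,B_V$), then $W\otimes V$ is a Bessel fusion sequence (fusion frame, fusion Riesz sequence) for $S_2(H)$ with bound $B_VB_W$ (respectively bounds $A_VA_W$, $B_VB_W$). 2. $W$ and $V$ are both fusion frames for $H$ if and only if $W\otimes V$ is a fusion frame for $S_2(H)$. Moreover, if $W\otimes V$ is a fusion frame with bounds $A,B$, then $A=A_VA_W$ and $B=B_VB_W$ for some frame bounds $A_W,B_W$ of $W$ and $A_V,B_V$ of $V$. 3. Suppose that some $W_j\neq\{0\}$ and some $V_i\ne\{0\}$. Then $W$ and $V$ are both Bessel fusion sequences if and only if $W\otimes V$ is a Bessel fusion sequence for $S_2(H)$, and every Bessel bound $B$ of $W\otimes V$ is a product $B_VB_W$ of Bessel bounds of $V$ and $W$. Likewise, $W$ and $V$ are both fusion Riesz sequences if and only if $W\otimes V$ is a fusion Riesz sequence in $S_2(H)$, and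 then any Riesz bounds $A,B$ of $W\otimes V$ are of the form $A=A_VA_W$, $B=B_VB_W$ with Riesz bounds $A_W,B_W$ of $W$ and $A_V,B_V$ of $V$. -/

import Mathlib

open scoped InnerProductSpace

/-! ### Hilbert–Schmidt operators -/

section HilbertSchmidt

variable (𝕜 : Type*) [RCLike 𝕜]
variable (E : Type*) [NormedAddCommGroup E] [InnerProductSpace 𝕜 E]
variable (F : Type*) [NormedAddCommGroup F] [InnerProductSpace 𝕜 F]

/-- A bounded operator `T : E → F` is Hilbert–Schmidt if `∑ i, ‖T (b i)‖ ^ 2 < ∞` for every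
orthonormal basis `b` of the Hilbert space `E`. -/
def IsHilbertSchmidt {𝕜 E F : Type*} [RCLike 𝕜] [NormedAddCommGroup E] [InnerProductSpace 𝕜 E]
    [NormedAddCommGroup F] [InnerProductSpace 𝕜 F] (T : E →L[𝕜] F) : Prop :=
  ∀ (s : Set E) (b : HilbertBasis s 𝕜 E), Summable fun i => ‖T (b i)‖ ^ 2

/-- The Hilbert–Schmidt operators as a linear subspace of the bounded operators. -/
def hilbertSchmidtSubmodule : Submodule 𝕜 (E →L[𝕜] F) where
  carrier := {T | IsHilbertSchmidt T}
  zero_mem' := fun s b => by simp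
  add_mem' := by
    intro S T hS hT s b
    refine Summable.of_nonneg_of_le (fun _ => by positivity) (fun i => ?_)
      (((hS s b).add (hT s b)).mul_left 2)
    have h := norm_add_le (S (b i)) (T (b i))
    have h0 := norm_nonneg (S (b i) + T (b i))
    rw [add_apply]
    nlinarith [sq_nonneg (‖S (b i)‖ - ‖T (b i)‖)]
  smul_mem' := by
    intro c T hT s b
    simpa [norm_smul, mul_pow] using (hT s b).mul_left (‖c‖ ^ 2)

/-- The space `S₂(E, F)` of Hilbert–Schmidt operators from `E` to `F`. It is a type of its own, so
that it carries the Hilbert–Schmidt norm and not the operator norm. -/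
def HilbertSchmidt : Type _ := hilbertSchmidtSubmodule 𝕜 E F

namespace HilbertSchmidt

noncomputable instance instAddCommGroup : AddCommGroup (HilbertSchmidt 𝕜 E F) :=
  inferInstanceAs (AddCommGroup (hilbertSchmidtSubmodule 𝕜 E F))

noncomputable instance instModule : Module 𝕜 (HilbertSchmidt 𝕜 E F) :=
  inferInstanceAs (Module 𝕜 (hilbertSchmidtSubmodule 𝕜 E F))

/-- The bounded operator underlying a Hilbert–Schmidt operator. -/
noncomputable def toCLM : HilbertSchmidt 𝕜 E F →ₗ[𝕜] (E →L[𝕜] F) :=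
  (hilbertSchmidtSubmodule 𝕜 E F).subtype

end HilbertSchmidt

end HilbertSchmidt

namespace HilbertSchmidt

variable {𝕜 : Type*} [RCLike 𝕜]
variable {E : Type*} [NormedAddCommGroup E] [InnerProductSpace 𝕜 E]
variable {F : Type*} [NormedAddCommGroup F] [InnerProductSpace 𝕜 F]
variable {G : Type*} [NormedAddCommGroup G] [InnerProductSpace 𝕜 G]

theorem toCLM_injective : Function.Injective (toCLM 𝕜 E F) := Subtype.val_injective

theorem isHilbertSchmidt (T : HilbertSchmidt 𝕜 E F) : IsHilbertSchmidt (toCLM 𝕜 E F T) :=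
  T.2

/-- A bounded operator that is Hilbert–Schmidt, as an element of `S₂(E, F)`. -/
def ofCLM (T : E →L[𝕜] F) (hT : IsHilbertSchmidt T) : HilbertSchmidt 𝕜 E F := ⟨T, hT⟩

theorem toCLM_ofCLM (T : E →L[𝕜] F) (hT : IsHilbertSchmidt T) : toCLM 𝕜 E F (ofCLM T hT) = T := rfl

theorem hasSum_sq_inner {ι : Type*} (b : HilbertBasis ι 𝕜 E) (x : E) :
    HasSum (fun i => ‖⟪b i, x⟫_𝕜‖ ^ 2) (‖x‖ ^ 2) := by
  have h := (RCLike.reCLM (K := 𝕜)).hasSum (b.hasSum_inner_mul_inner x x)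
  rw [RCLike.reCLM_apply, inner_self_eq_norm_sq (𝕜 := 𝕜)] at h
  have hfun : (fun i => ‖⟪b i, x⟫_𝕜‖ ^ 2) =
      fun i => RCLike.reCLM (K := 𝕜) (⟪x, b i⟫_𝕜 * ⟪b i, x⟫_𝕜) := by
    funext i
    rw [RCLike.reCLM_apply, ← inner_conj_symm x, RCLike.conj_mul]
    norm_cast
  rw [hfun]
  exact h

theorem enorm_sq_eq_tsum {ι : Type*} (b : HilbertBasis ι 𝕜 E) (x : E) :
    ENNReal.ofReal (‖x‖ ^ 2) = ∑' i, ENNReal.ofReal (‖⟪b i, x⟫_𝕜‖ ^ 2) := by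
  rw [← (hasSum_sq_inner b x).tsum_eq,
    ENNReal.ofReal_tsum_of_nonneg (fun _ => by positivity) (hasSum_sq_inner b x).summable]

theorem tsum_adjoint [CompleteSpace E] [CompleteSpace F] {ι κ : Type*} (b : HilbertBasis ι 𝕜 E)
    (c : HilbertBasis κ 𝕜 F) (T : E →L[𝕜] F) :
    ∑' i, ENNReal.ofReal (‖T (b i)‖ ^ 2) =
      ∑' j, ENNReal.ofReal (‖(ContinuousLinearMap.adjoint T) (c j)‖ ^ 2) := by
  simp_rw [enorm_sq_eq_tsum c (T _), enorm_sq_eq_tsum b (ContinuousLinearMap.adjoint T _)]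
  rw [ENNReal.tsum_comm]
  simp_rw [ContinuousLinearMap.adjoint_inner_right, norm_inner_symm (T _)]

theorem summable_iff {ι : Type*} {f : ι → ℝ} (hf : ∀ i, 0 ≤ f i) :
    Summable f ↔ ∑' i, ENNReal.ofReal (f i) ≠ ⊤ := by
  refine ⟨fun h => h.tsum_ofReal_ne_top, fun h => ?_⟩
  simpa [ENNReal.toReal_ofReal (hf _)] using ENNReal.summable_toReal h

/-- The sum of squares does not depend on the orthonormal basis. -/
theorem tsum_basis_indep [CompleteSpace E] [CompleteSpace F] {ι κ : Type*}
    (b : HilbertBasis ι 𝕜 E) (c : HilbertBasis κ 𝕜 E) (T : E →L[𝕜] F) :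
    ∑' i, ENNReal.ofReal (‖T (b i)‖ ^ 2) = ∑' j, ENNReal.ofReal (‖T (c j)‖ ^ 2) := by
  obtain ⟨w, d, -⟩ := exists_hilbertBasis 𝕜 F
  rw [tsum_adjoint b d, tsum_adjoint c d]

/-- One orthonormal basis is enough to test the Hilbert–Schmidt property. -/
theorem isHilbertSchmidt_iff [CompleteSpace E] [CompleteSpace F] {ι : Type*}
    (b : HilbertBasis ι 𝕜 E) (T : E →L[𝕜] F) :
    IsHilbertSchmidt T ↔ Summable fun i => ‖T (b i)‖ ^ 2 := by
  constructor
  · intro h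
    obtain ⟨w, d, -⟩ := exists_hilbertBasis 𝕜 E
    rw [summable_iff (fun _ => by positivity), tsum_basis_indep b d,
      ← summable_iff (fun _ => by positivity)]
    exact h w d
  · intro h s d
    rw [summable_iff (fun _ => by positivity), tsum_basis_indep d b,
      ← summable_iff (fun _ => by positivity)]
    exact h

theorem isHilbertSchmidt_adjoint [CompleteSpace E] [CompleteSpace F] {T : E →L[𝕜] F}
    (hT : IsHilbertSchmidt T) : IsHilbertSchmidt (ContinuousLinearMap.adjoint T) := by
  obtain ⟨w, d, -⟩ := exists_hilbertBasis 𝕜 E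
  intro s c
  rw [summable_iff (fun _ => by positivity), ← tsum_adjoint d c,
    ← summable_iff (fun _ => by positivity)]
  exact hT w d

theorem isHilbertSchmidt_comp_left {T : E →L[𝕜] F} (hT : IsHilbertSchmidt T) (A : F →L[𝕜] G) :
    IsHilbertSchmidt (A ∘L T) := by
  intro s b
  refine Summable.of_nonneg_of_le (fun _ => by positivity) (fun i => ?_)
    ((hT s b).mul_left (‖A‖ ^ 2))
  rw [← mul_pow]
  exact pow_le_pow_left₀ (norm_nonneg _) (A.le_opNorm _) 2

theorem isHilbertSchmidt_comp_right [CompleteSpace E] [CompleteSpace F] [CompleteSpace G]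
    {T : E →L[𝕜] F} (hT : IsHilbertSchmidt T) (A : G →L[𝕜] E) : IsHilbertSchmidt (T ∘L A) := by
  have h := isHilbertSchmidt_adjoint (isHilbertSchmidt_comp_left (isHilbertSchmidt_adjoint hT)
    (ContinuousLinearMap.adjoint A))
  rwa [ContinuousLinearMap.adjoint_comp, ContinuousLinearMap.adjoint_adjoint,
    ContinuousLinearMap.adjoint_adjoint] at h

section Hilbert

variable (𝕜 E) in
/-- The index set of a fixed orthonormal basis of the Hilbert space `E`. -/
def stdIndex [CompleteSpace E] : Set E := (exists_hilbertBasis 𝕜 E).choose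

variable (𝕜 E) in
/-- A fixed orthonormal basis of the Hilbert space `E`. -/
noncomputable def stdBasis [CompleteSpace E] : HilbertBasis (stdIndex 𝕜 E) 𝕜 E :=
  (exists_hilbertBasis 𝕜 E).choose_spec.choose

variable [CompleteSpace E]

/-- The family `(T eᵢ)ᵢ` as an element of `ℓ²(F)`. -/
noncomputable def toLp : HilbertSchmidt 𝕜 E F →ₗ[𝕜] lp (fun _ : stdIndex 𝕜 E => F) 2 where
  toFun T := ⟨fun i => toCLM 𝕜 E F T (stdBasis 𝕜 E i), memℓp_gen (by
    simpa using T.isHilbertSchmidt _ (stdBasis 𝕜 E))⟩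
  map_add' S T := by ext i; simp; rfl
  map_smul' c T := by ext i; simp

theorem toLp_apply (T : HilbertSchmidt 𝕜 E F) (i : stdIndex 𝕜 E) :
    toLp T i = toCLM 𝕜 E F T (stdBasis 𝕜 E i) := rfl

theorem ext_basis {ι : Type*} (b : HilbertBasis ι 𝕜 E) {S T : E →L[𝕜] F}
    (h : ∀ i, S (b i) = T (b i)) : S = T := by
  refine ContinuousLinearMap.ext_on (s := Set.range b) ?_ ?_
  · rw [Submodule.dense_iff_topologicalClosure_eq_top]
    exact b.dense_span
  · rintro _ ⟨i, rfl⟩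
    exact h i

theorem toLp_injective : Function.Injective (toLp (𝕜 := 𝕜) (E := E) (F := F)) := by
  intro S T h
  refine toCLM_injective (ext_basis (stdBasis 𝕜 E) fun i => ?_)
  rw [← toLp_apply, h, toLp_apply]

theorem tsum_inner_eq (S T : HilbertSchmidt 𝕜 E F) :
    ∑' i, ⟪toCLM 𝕜 E F S (stdBasis 𝕜 E i), toCLM 𝕜 E F T (stdBasis 𝕜 E i)⟫_𝕜 =
      ⟪toLp S, toLp T⟫_𝕜 :=
  (lp.inner_eq_tsum (𝕜 := 𝕜) (toLp S) (toLp T)).symm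

variable (𝕜 E F) in
/-- The inner product `⟪S, T⟫ = trace (S* T) = ∑ i, ⟪S eᵢ, T eᵢ⟫` on `S₂(E, F)`. -/
@[reducible] noncomputable def innerCore : InnerProductSpace.Core 𝕜 (HilbertSchmidt 𝕜 E F) where
  inner S T := ∑' i, ⟪toCLM 𝕜 E F S (stdBasis 𝕜 E i), toCLM 𝕜 E F T (stdBasis 𝕜 E i)⟫_𝕜
  conj_inner_symm S T := by rw [tsum_inner_eq, tsum_inner_eq, inner_conj_symm]
  re_inner_nonneg S := by rw [tsum_inner_eq]; exact inner_self_nonneg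
  add_left R S T := by rw [tsum_inner_eq, tsum_inner_eq, tsum_inner_eq, map_add, inner_add_left]
  smul_left S T c := by rw [tsum_inner_eq, tsum_inner_eq, map_smul, inner_smul_left]
  definite S h := by
    rw [tsum_inner_eq, inner_self_eq_zero] at h
    exact toLp_injective (h.trans (map_zero _).symm)

noncomputable instance instNormedAddCommGroup : NormedAddCommGroup (HilbertSchmidt 𝕜 E F) :=
  (innerCore 𝕜 E F).toNormedAddCommGroup

noncomputable instance instInnerProductSpace : InnerProductSpace 𝕜 (HilbertSchmidt 𝕜 E F) :=
  InnerProductSpace.ofCore (innerCore 𝕜 E F).toCore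

theorem inner_def (S T : HilbertSchmidt 𝕜 E F) : ⟪S, T⟫_𝕜 =
    ∑' i, ⟪toCLM 𝕜 E F S (stdBasis 𝕜 E i), toCLM 𝕜 E F T (stdBasis 𝕜 E i)⟫_𝕜 := rfl

theorem inner_eq_toLp (S T : HilbertSchmidt 𝕜 E F) : ⟪S, T⟫_𝕜 = ⟪toLp S, toLp T⟫_𝕜 :=
  tsum_inner_eq S T

theorem norm_toLp (T : HilbertSchmidt 𝕜 E F) : ‖toLp T‖ = ‖T‖ := by
  rw [norm_eq_sqrt_re_inner (𝕜 := 𝕜), norm_eq_sqrt_re_inner (𝕜 := 𝕜) T, inner_eq_toLp]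

/-- The Hilbert–Schmidt norm may be computed in any orthonormal basis. -/
theorem hasSum_norm_sq [CompleteSpace F] {ι : Type*} (b : HilbertBasis ι 𝕜 E)
    (T : HilbertSchmidt 𝕜 E F) :
    HasSum (fun i => ‖toCLM 𝕜 E F T (b i)‖ ^ 2) (‖T‖ ^ 2) := by
  have hs := (isHilbertSchmidt_iff b _).1 T.isHilbertSchmidt
  have hs' := (isHilbertSchmidt_iff (stdBasis 𝕜 E) _).1 T.isHilbertSchmidt
  have key := tsum_basis_indep b (stdBasis 𝕜 E) (toCLM 𝕜 E F T)
  rw [← ENNReal.ofReal_tsum_of_nonneg (fun _ => by positivity) hs,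
    ← ENNReal.ofReal_tsum_of_nonneg (fun _ => by positivity) hs',
    ENNReal.ofReal_eq_ofReal_iff (tsum_nonneg fun _ => by positivity)
      (tsum_nonneg fun _ => by positivity)] at key
  have hn : ‖T‖ ^ 2 = ∑' i, ‖toCLM 𝕜 E F T (stdBasis 𝕜 E i)‖ ^ 2 := by
    rw [← norm_toLp]
    simpa [toLp_apply] using lp.norm_rpow_eq_tsum (p := 2) (by norm_num) (toLp T)
  rw [hn, ← key]
  exact hs.hasSum

/-- The operator norm is at most the Hilbert–Schmidt norm. -/
theorem norm_toCLM_le [CompleteSpace F] (T : HilbertSchmidt 𝕜 E F) :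
    ‖toCLM 𝕜 E F T‖ ≤ ‖T‖ := by
  rw [← LinearIsometryEquiv.norm_map ContinuousLinearMap.adjoint (toCLM 𝕜 E F T)]
  refine ContinuousLinearMap.opNorm_le_bound _ (norm_nonneg _) fun y => ?_
  refine le_of_sq_le_sq ?_ (by positivity)
  rw [mul_pow]
  refine hasSum_le (fun i => ?_) (hasSum_sq_inner (stdBasis 𝕜 E) _)
    ((hasSum_norm_sq (stdBasis 𝕜 E) T).mul_right (‖y‖ ^ 2))
  rw [ContinuousLinearMap.adjoint_inner_right, ← mul_pow]
  exact pow_le_pow_left₀ (norm_nonneg _) (norm_inner_le_norm _ _) 2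

theorem continuous_toCLM [CompleteSpace F] : Continuous (toCLM 𝕜 E F) :=
  AddMonoidHomClass.continuous_of_bound (toCLM 𝕜 E F) 1 fun T => by
    simpa using norm_toCLM_le T

theorem toLp_surjective [CompleteSpace F] :
    Function.Surjective (toLp (𝕜 := 𝕜) (E := E) (F := F)) := by
  intro y
  have hy : Summable fun i => ‖y i‖ ^ 2 := by simpa using (lp.memℓp y).summable (by norm_num)
  have hle : ∀ (f : F) i, ‖⟪y i, f⟫_𝕜‖ ^ 2 ≤ ‖y i‖ ^ 2 * ‖f‖ ^ 2 := fun f i => by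
    rw [← mul_pow]
    exact pow_le_pow_left₀ (norm_nonneg _) (norm_inner_le_norm _ _) 2
  have hs : ∀ f : F, Summable fun i => ‖⟪y i, f⟫_𝕜‖ ^ 2 := fun f =>
    Summable.of_nonneg_of_le (fun _ => by positivity) (hle f) (hy.mul_right (‖f‖ ^ 2))
  let A : F →ₗ[𝕜] lp (fun _ : stdIndex 𝕜 E => 𝕜) 2 :=
    { toFun := fun f => ⟨fun i => ⟪y i, f⟫_𝕜, memℓp_gen (by simpa using hs f)⟩
      map_add' := fun f g => by ext i; simp [inner_add_right]; rfl
      map_smul' := fun c f => by ext i; simp [inner_smul_right] }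
  have hA : ∀ f, ‖A f‖ ≤ ‖y‖ * ‖f‖ := fun f => by
    refine le_of_sq_le_sq ?_ (by positivity)
    have h1 : ‖A f‖ ^ 2 = ∑' i, ‖⟪y i, f⟫_𝕜‖ ^ 2 := by
      simpa [A] using lp.norm_rpow_eq_tsum (p := 2) (by norm_num) (A f)
    have h2 : ‖y‖ ^ 2 = ∑' i, ‖y i‖ ^ 2 := by
      simpa using lp.norm_rpow_eq_tsum (p := 2) (by norm_num) y
    rw [mul_pow, h1, h2, ← tsum_mul_right]
    exact (hs f).tsum_le_tsum (hle f) (hy.mul_right _)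
  let S : F →L[𝕜] E :=
    (stdBasis 𝕜 E).repr.symm.toContinuousLinearEquiv.toContinuousLinearMap ∘L
      (A.mkContinuous ‖y‖ hA)
  have hS : ∀ i, (ContinuousLinearMap.adjoint S) (stdBasis 𝕜 E i) = y i := fun i => by
    refine ext_inner_right 𝕜 fun f => ?_
    rw [ContinuousLinearMap.adjoint_inner_left, ← HilbertBasis.repr_apply_apply]
    simp [S, A]
  refine ⟨ofCLM (ContinuousLinearMap.adjoint S) ?_, ?_⟩
  · rw [isHilbertSchmidt_iff (stdBasis 𝕜 E)]
    simpa only [hS] using hy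
  · ext i
    rw [toLp_apply, toCLM_ofCLM, hS]

/-- `S₂(E, F)` is a Hilbert space. -/
instance instCompleteSpace [CompleteSpace F] : CompleteSpace (HilbertSchmidt 𝕜 E F) := by
  let e : HilbertSchmidt 𝕜 E F ≃ₗᵢ[𝕜] lp (fun _ : stdIndex 𝕜 E => F) 2 :=
    LinearIsometryEquiv.ofSurjective ⟨toLp, norm_toLp⟩ toLp_surjective
  exact e.toIsometryEquiv.completeSpace

end Hilbert

end HilbertSchmidt

/-! ### Fusion systems -/

/-- A family `(Wᵢ, wᵢ)` of closed subspaces of `H` with weights `wᵢ > 0`. -/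
structure FusionSystem (ι 𝕜 H : Type*) [RCLike 𝕜] [NormedAddCommGroup H]
    [InnerProductSpace 𝕜 H] where
  subspace : ι → Submodule 𝕜 H
  isClosed_subspace : ∀ i, IsClosed (subspace i : Set H)
  weight : ι → ℝ
  weight_pos : ∀ i, 0 < weight i

namespace FusionSystem

variable {ι κ 𝕜 H : Type*} [RCLike 𝕜] [NormedAddCommGroup H] [InnerProductSpace 𝕜 H]
  [CompleteSpace H]

instance instCompleteSpaceSubspace (W : FusionSystem ι 𝕜 H) (i : ι) :
    CompleteSpace (W.subspace i) :=
  (W.isClosed_subspace i).completeSpace_coe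

/-- `B` is a Bessel bound: `∑ wᵢ² ‖π_{Wᵢ} f‖² ≤ B ‖f‖²` for all `f`. -/
def HasBesselBound (W : FusionSystem ι 𝕜 H) (B : ℝ) : Prop :=
  0 < B ∧ ∀ f : H,
    (Summable fun i => W.weight i ^ 2 * ‖(W.subspace i).starProjection f‖ ^ 2) ∧
    ∑' i, W.weight i ^ 2 * ‖(W.subspace i).starProjection f‖ ^ 2 ≤ B * ‖f‖ ^ 2

/-- `A ≤ B` are fusion frame bounds: `A ‖f‖² ≤ ∑ wᵢ² ‖π_{Wᵢ} f‖² ≤ B ‖f‖²` for all `f`. -/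
def HasFrameBounds (W : FusionSystem ι 𝕜 H) (A B : ℝ) : Prop :=
  0 < A ∧ A ≤ B ∧ ∀ f : H,
    (Summable fun i => W.weight i ^ 2 * ‖(W.subspace i).starProjection f‖ ^ 2) ∧
    A * ‖f‖ ^ 2 ≤ ∑' i, W.weight i ^ 2 * ‖(W.subspace i).starProjection f‖ ^ 2 ∧
    ∑' i, W.weight i ^ 2 * ‖(W.subspace i).starProjection f‖ ^ 2 ≤ B * ‖f‖ ^ 2

/-- `A ≤ B` are Riesz bounds: `A ∑ ‖fⱼ‖² ≤ ‖∑ wⱼ fⱼ‖² ≤ B ∑ ‖fⱼ‖²` for all finite sums with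
`fⱼ ∈ Wⱼ`. -/
def HasRieszBounds (W : FusionSystem ι 𝕜 H) (A B : ℝ) : Prop :=
  0 < A ∧ A ≤ B ∧ ∀ (J : Finset ι) (f : ∀ i, W.subspace i),
    A * ∑ j ∈ J, ‖f j‖ ^ 2 ≤ ‖∑ j ∈ J, (W.weight j : 𝕜) • (f j : H)‖ ^ 2 ∧
    ‖∑ j ∈ J, (W.weight j : 𝕜) • (f j : H)‖ ^ 2 ≤ B * ∑ j ∈ J, ‖f j‖ ^ 2

/-- Bessel fusion sequences. -/
def IsBessel (W : FusionSystem ι 𝕜 H) : Prop := ∃ B, W.HasBesselBound B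

/-- Fusion frames. -/
def IsFrame (W : FusionSystem ι 𝕜 H) : Prop := ∃ A B, W.HasFrameBounds A B

/-- Fusion Riesz sequences. -/
def IsRieszSequence (W : FusionSystem ι 𝕜 H) : Prop := ∃ A B, W.HasRieszBounds A B

end FusionSystem

/-! ### Tensor products -/

section Tensor

variable {ι κ 𝕜 H : Type*} [RCLike 𝕜] [NormedAddCommGroup H] [InnerProductSpace 𝕜 H]
  [CompleteSpace H]

/-- `W ⊗ V`: the space `S₂(V, W)` of Hilbert–Schmidt operators from `V` to `W`, regarded as a
subspace of `S₂(H)`: an operator `U : V → W` is identified with `f ↦ U (π_V f)`. -/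
def tensorSubspace (W V : Submodule 𝕜 H) [CompleteSpace V] :
    Submodule 𝕜 (HilbertSchmidt 𝕜 H H) where
  carrier := {T | ∃ U : HilbertSchmidt 𝕜 V W, HilbertSchmidt.toCLM 𝕜 H H T =
    W.subtypeL ∘L HilbertSchmidt.toCLM 𝕜 V W U ∘L V.orthogonalProjectionOnto}
  zero_mem' := ⟨0, by ext; simp⟩
  add_mem' := by
    rintro S T ⟨U, hU⟩ ⟨U', hU'⟩
    exact ⟨U + U', by ext; simp [hU, hU']⟩
  smul_mem' := by
    rintro c T ⟨U, hU⟩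
    exact ⟨c • U, by ext; simp [hU]⟩

/-- `W ⊗ V` consists of the `T` in `S₂(H)` with `π_W T π_V = T`. -/
theorem mem_tensorSubspace_iff (W V : Submodule 𝕜 H) [CompleteSpace W] [CompleteSpace V]
    (T : HilbertSchmidt 𝕜 H H) :
    T ∈ tensorSubspace W V ↔
      W.starProjection ∘L HilbertSchmidt.toCLM 𝕜 H H T ∘L V.starProjection =
        HilbertSchmidt.toCLM 𝕜 H H T := by
  constructor
  · rintro ⟨U, hU⟩
    ext f
    have hf : V.orthogonalProjectionOnto (V.starProjection f) = V.orthogonalProjectionOnto f := by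
      refine Subtype.ext ?_
      rw [Submodule.coe_orthogonalProjectionOnto_apply, Submodule.coe_orthogonalProjectionOnto_apply]
      exact Submodule.starProjection_eq_self_iff.2 (Submodule.starProjection_apply_mem _ _)
    rw [hU]
    simp [hf]
  · intro h
    refine ⟨HilbertSchmidt.ofCLM (W.orthogonalProjectionOnto ∘L HilbertSchmidt.toCLM 𝕜 H H T ∘L
      V.subtypeL) (HilbertSchmidt.isHilbertSchmidt_comp_left
        (HilbertSchmidt.isHilbertSchmidt_comp_right T.isHilbertSchmidt _) _), ?_⟩
    rw [HilbertSchmidt.toCLM_ofCLM]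
    exact h.symm

theorem isClosed_tensorSubspace (W V : Submodule 𝕜 H) [CompleteSpace W] [CompleteSpace V] :
    IsClosed (tensorSubspace W V : Set (HilbertSchmidt 𝕜 H H)) := by
  have h : (tensorSubspace W V : Set (HilbertSchmidt 𝕜 H H)) =
      {T | W.starProjection ∘L HilbertSchmidt.toCLM 𝕜 H H T ∘L V.starProjection =
        HilbertSchmidt.toCLM 𝕜 H H T} := Set.ext fun T => mem_tensorSubspace_iff W V T
  rw [h]
  have hc := HilbertSchmidt.continuous_toCLM (𝕜 := 𝕜) (E := H) (F := H)
  exact isClosed_eq (continuous_const.clm_comp (hc.clm_comp continuous_const)) hc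

/-- The system `W ⊗ V = (Wⱼ ⊗ Vᵢ, vᵢ wⱼ)`, indexed by the pairs `(j, i)`, in `S₂(H)`. -/
noncomputable def FusionSystem.tensor (W : FusionSystem ι 𝕜 H) (V : FusionSystem κ 𝕜 H) :
    FusionSystem (ι × κ) 𝕜 (HilbertSchmidt 𝕜 H H) where
  subspace p := tensorSubspace (W.subspace p.1) (V.subspace p.2)
  isClosed_subspace := fun _ => isClosed_tensorSubspace _ _
  weight := fun p => V.weight p.2 * W.weight p.1
  weight_pos := fun p => mul_pos (V.weight_pos p.2) (W.weight_pos p.1)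

end Tensor

/-! ### Adjoints, compositions and rank one operators in `S₂` -/

namespace HilbertSchmidt

variable {𝕜 : Type*} [RCLike 𝕜]
variable {E : Type*} [NormedAddCommGroup E] [InnerProductSpace 𝕜 E] [CompleteSpace E]
variable {F : Type*} [NormedAddCommGroup F] [InnerProductSpace 𝕜 F] [CompleteSpace F]
variable {G : Type*} [NormedAddCommGroup G] [InnerProductSpace 𝕜 G] [CompleteSpace G]

/-! The orthogonal projection onto `W_j ⊗ V_i` is `T ↦ π_{W_j} T π_{V_i}`
(`starProjection_tensorSubspace`), so the two systems act on the two sides of `T` independently. The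
squared Hilbert–Schmidt norm is the sum of `‖T e‖²` over an orthonormal basis, so an inequality of
`W` for vectors, applied to every `T e` and summed, becomes one for operators. The adjoint is
isometric and gives `‖T π_{V_i}‖ = ‖π_{V_i} T*‖`, so the same argument handles `V`. Using `W` on
each `T π_{V_i}` and then `V` on `T*` multiplies the bounds; Riesz bounds multiply in the same way,
with partial sums over `i` in place of `T π_{V_i}`.

For the converses, test on rank one operators `f ⊗ g`, where norms, energies and weighted sums all
factor (`norm_rankOne`, `energy_tensor_rankOne`, `rankOne_sum_smul`). The bounds of `W ⊗ V` then
read `A n(x) m(y) ≤ P(x) Q(y) ≤ B n(x) m(y)` with `x` and `y` independent. Such inequalities split: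
the best constant for `P` against `n` is a supremum or infimum of `P/n`, and what is left of `B` or
`A` serves `Q` against `m` (`exists_upper_split`, `exists_lower_split`). -/

omit [CompleteSpace E] [CompleteSpace F] in
theorem ext_toCLM {S T : HilbertSchmidt 𝕜 E F} (h : ∀ x, toCLM 𝕜 E F S x = toCLM 𝕜 E F T x) :
    S = T :=
  toCLM_injective (ContinuousLinearMap.ext h)

/-- The adjoint of a Hilbert–Schmidt operator. -/
noncomputable def adjoint (T : HilbertSchmidt 𝕜 E F) : HilbertSchmidt 𝕜 F E :=
  ofCLM (ContinuousLinearMap.adjoint (toCLM 𝕜 E F T)) (isHilbertSchmidt_adjoint T.isHilbertSchmidt)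

theorem toCLM_adjoint (T : HilbertSchmidt 𝕜 E F) :
    toCLM 𝕜 F E (adjoint T) = ContinuousLinearMap.adjoint (toCLM 𝕜 E F T) := rfl

/-- The composition `A T` of a Hilbert–Schmidt operator with a bounded operator. -/
noncomputable def compLeft (A : F →L[𝕜] G) (T : HilbertSchmidt 𝕜 E F) : HilbertSchmidt 𝕜 E G :=
  ofCLM (A ∘L toCLM 𝕜 E F T) (isHilbertSchmidt_comp_left T.isHilbertSchmidt A)

/-- The composition `T A` of a Hilbert–Schmidt operator with a bounded operator. -/
noncomputable def compRight (T : HilbertSchmidt 𝕜 E F) (A : G →L[𝕜] E) : HilbertSchmidt 𝕜 G F :=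
  ofCLM (toCLM 𝕜 E F T ∘L A) (isHilbertSchmidt_comp_right T.isHilbertSchmidt A)

omit [CompleteSpace E] [CompleteSpace F] [CompleteSpace G] in
theorem compLeft_apply (A : F →L[𝕜] G) (T : HilbertSchmidt 𝕜 E F) (x : E) :
    toCLM 𝕜 E G (compLeft A T) x = A (toCLM 𝕜 E F T x) := rfl

theorem compRight_apply (T : HilbertSchmidt 𝕜 E F) (A : G →L[𝕜] E) (x : G) :
    toCLM 𝕜 G F (compRight T A) x = toCLM 𝕜 E F T (A x) := rfl

theorem adjoint_compRight (T : HilbertSchmidt 𝕜 E F) (A : G →L[𝕜] E) :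
    adjoint (compRight T A) = compLeft (ContinuousLinearMap.adjoint A) (adjoint T) :=
  toCLM_injective (ContinuousLinearMap.adjoint_comp _ _)

theorem adjoint_sum_smul {ι : Type*} (J : Finset ι) (w : ι → ℝ) (X : ι → HilbertSchmidt 𝕜 E F) :
    adjoint (∑ i ∈ J, (w i : 𝕜) • X i) = ∑ i ∈ J, (w i : 𝕜) • adjoint (X i) :=
  toCLM_injective (by
    simp only [toCLM_adjoint, map_sum, map_smul]
    simp only [map_smulₛₗ, RCLike.conj_ofReal])

theorem ofReal_norm_sq {ι : Type*} (b : HilbertBasis ι 𝕜 E) (T : HilbertSchmidt 𝕜 E F) :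
    ENNReal.ofReal (‖T‖ ^ 2) = ∑' i, ENNReal.ofReal (‖toCLM 𝕜 E F T (b i)‖ ^ 2) := by
  rw [← (hasSum_norm_sq b T).tsum_eq,
    ENNReal.ofReal_tsum_of_nonneg (fun _ => by positivity) (hasSum_norm_sq b T).summable]

/-- Both squares are the double sum of `|⟪c j, T (b i)⟫|²`, summed in either order. This is what
lets every statement about the range of `T` be reused on the domain side. -/
theorem norm_adjoint (T : HilbertSchmidt 𝕜 E F) : ‖adjoint T‖ = ‖T‖ := by
  have h := tsum_adjoint (stdBasis 𝕜 E) (stdBasis 𝕜 F) (toCLM 𝕜 E F T)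
  rw [← toCLM_adjoint, ← ofReal_norm_sq, ← ofReal_norm_sq,
    ENNReal.ofReal_eq_ofReal_iff (by positivity) (by positivity)] at h
  exact ((sq_eq_sq₀ (norm_nonneg _) (norm_nonneg _)).1 h).symm

/-- Pythagoras for each `T (b i)`, summed over the basis. -/
theorem norm_sq_eq_compLeft (P : Submodule 𝕜 F) [CompleteSpace P] (T : HilbertSchmidt 𝕜 E F) :
    ‖T‖ ^ 2 = ‖compLeft P.starProjection T‖ ^ 2 + ‖compLeft Pᗮ.starProjection T‖ ^ 2 := by
  refine (hasSum_norm_sq (stdBasis 𝕜 E) T).unique ?_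
  convert (hasSum_norm_sq (stdBasis 𝕜 E) (compLeft P.starProjection T)).add
    (hasSum_norm_sq (stdBasis 𝕜 E) (compLeft Pᗮ.starProjection T)) using 2 with i
  exact Submodule.norm_sq_eq_add_norm_sq_starProjection _ P

theorem norm_compRight_starProjection (Q : Submodule 𝕜 E) [CompleteSpace Q]
    (T : HilbertSchmidt 𝕜 E F) :
    ‖compRight T Q.starProjection‖ = ‖compLeft Q.starProjection (adjoint T)‖ := by
  rw [← norm_adjoint, adjoint_compRight, (isSelfAdjoint_starProjection Q).adjoint_eq]

theorem norm_sq_eq_compRight (Q : Submodule 𝕜 E) [CompleteSpace Q] (T : HilbertSchmidt 𝕜 E F) :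
    ‖T‖ ^ 2 = ‖compRight T Q.starProjection‖ ^ 2 + ‖compRight T Qᗮ.starProjection‖ ^ 2 := by
  rw [norm_compRight_starProjection, norm_compRight_starProjection, ← norm_sq_eq_compLeft,
    norm_adjoint]

/-- The rank one operator `f ⊗ g : x ↦ ⟪g, x⟫ f`. -/
noncomputable def rankOne (f : F) (g : E) : HilbertSchmidt 𝕜 E F :=
  ofCLM (InnerProductSpace.rankOne 𝕜 f g) <| by
    intro s b
    simpa only [InnerProductSpace.rankOne_apply, norm_smul, mul_pow, norm_inner_symm g] using
      (hasSum_sq_inner b g).summable.mul_right (‖f‖ ^ 2)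

omit [CompleteSpace E] [CompleteSpace F] in
theorem rankOne_apply (f : F) (g x : E) :
    toCLM 𝕜 E F (rankOne f g) x = ⟪g, x⟫_𝕜 • f := rfl

theorem norm_rankOne (f : F) (g : E) : ‖(rankOne f g : HilbertSchmidt 𝕜 E F)‖ = ‖f‖ * ‖g‖ := by
  refine (sq_eq_sq₀ (by positivity) (by positivity)).1 ?_
  refine (hasSum_norm_sq (stdBasis 𝕜 E) _).unique ?_
  rw [mul_pow, mul_comm]
  simpa only [rankOne_apply, norm_smul, mul_pow, norm_inner_symm g] using
    (hasSum_sq_inner (stdBasis 𝕜 E) g).mul_right (‖f‖ ^ 2)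

-- `f ⊗ g` is conjugate linear in `g`, but the weights are real, so the double sum still factors.
omit [CompleteSpace E] [CompleteSpace F] in
theorem rankOne_sum_smul {ι κ : Type*} (J : Finset ι) (K : Finset κ) (w : ι → ℝ) (v : κ → ℝ)
    (f : ι → F) (g : κ → E) :
    ∑ p ∈ J ×ˢ K, ((v p.2 * w p.1 : ℝ) : 𝕜) • (rankOne (f p.1) (g p.2) : HilbertSchmidt 𝕜 E F) =
      rankOne (∑ j ∈ J, (w j : 𝕜) • f j) (∑ i ∈ K, (v i : 𝕜) • g i) := by
  refine ext_toCLM fun x => ?_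
  rw [rankOne_apply, sum_inner, Finset.sum_smul_sum, Finset.sum_product_right,
    map_sum]
  simp only [map_sum, map_smul, sum_apply, smul_apply,
    rankOne_apply]
  refine Finset.sum_congr rfl fun i _ => Finset.sum_congr rfl fun j _ => ?_
  rw [inner_smul_left, RCLike.conj_ofReal, smul_smul, smul_smul]
  push_cast
  congr 1
  ring

end HilbertSchmidt

/-! ### The orthogonal projection onto `P ⊗ Q` -/

section Projection

open HilbertSchmidt

variable {𝕜 H : Type*} [RCLike 𝕜] [NormedAddCommGroup H] [InnerProductSpace 𝕜 H]
  [CompleteSpace H] (P Q : Submodule 𝕜 H) [CompleteSpace P] [CompleteSpace Q]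

/-- The operator `π_P T π_Q`. -/
noncomputable def sandwich (T : HilbertSchmidt 𝕜 H H) : HilbertSchmidt 𝕜 H H :=
  compLeft P.starProjection (compRight T Q.starProjection)

theorem sandwich_apply (T : HilbertSchmidt 𝕜 H H) (x : H) :
    toCLM 𝕜 H H (sandwich P Q T) x =
      P.starProjection (toCLM 𝕜 H H T (Q.starProjection x)) := rfl

variable {P Q} in
theorem mem_tensorSubspace_iff_sandwich {T : HilbertSchmidt 𝕜 H H} :
    T ∈ tensorSubspace P Q ↔ sandwich P Q T = T :=
  (mem_tensorSubspace_iff P Q T).trans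
    ⟨fun h => toCLM_injective h, fun h => congrArg (toCLM 𝕜 H H) h⟩

theorem sandwich_mem (T : HilbertSchmidt 𝕜 H H) : sandwich P Q T ∈ tensorSubspace P Q := by
  rw [mem_tensorSubspace_iff_sandwich]
  refine ext_toCLM fun x => ?_
  simp only [sandwich_apply]
  rw [Submodule.starProjection_eq_self_iff.2 (Submodule.starProjection_apply_mem Q x),
    Submodule.starProjection_eq_self_iff.2 (Submodule.starProjection_apply_mem P _)]

variable {P Q} in
theorem apply_mem_of_mem_tensorSubspace {T : HilbertSchmidt 𝕜 H H} (hT : T ∈ tensorSubspace P Q)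
    (x : H) : toCLM 𝕜 H H T x ∈ P := by
  rw [← mem_tensorSubspace_iff_sandwich.1 hT, sandwich_apply]
  exact Submodule.starProjection_apply_mem _ _

theorem adjoint_sandwich (T : HilbertSchmidt 𝕜 H H) :
    adjoint (sandwich P Q T) = sandwich Q P (adjoint T) := by
  refine toCLM_injective ?_
  change ContinuousLinearMap.adjoint (P.starProjection ∘L toCLM 𝕜 H H T ∘L Q.starProjection) =
    Q.starProjection ∘L ContinuousLinearMap.adjoint (toCLM 𝕜 H H T) ∘L P.starProjection
  rw [ContinuousLinearMap.adjoint_comp, ContinuousLinearMap.adjoint_comp,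
    (isSelfAdjoint_starProjection Q).adjoint_eq, (isSelfAdjoint_starProjection P).adjoint_eq]
  rfl

variable {P Q} in
theorem adjoint_mem_tensorSubspace {T : HilbertSchmidt 𝕜 H H} (hT : T ∈ tensorSubspace P Q) :
    adjoint T ∈ tensorSubspace Q P := by
  rw [mem_tensorSubspace_iff_sandwich] at hT ⊢
  rw [← adjoint_sandwich, hT]

/-- Pythagoras on the left with `P`, then on the right with `Q`; the blocks outside `P ⊗ Q` do not
see `U`. Only the first term depends on `U`, so the distance from `T` is least exactly at `U = π_P T
π_Q`. -/
theorem norm_sub_sq_of_mem_tensorSubspace (T : HilbertSchmidt 𝕜 H H) {U : HilbertSchmidt 𝕜 H H}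
    (hU : U ∈ tensorSubspace P Q) :
    ‖T - U‖ ^ 2 = ‖sandwich P Q T - U‖ ^ 2 +
      ‖compLeft P.starProjection (compRight T Qᗮ.starProjection)‖ ^ 2 +
      ‖compLeft Pᗮ.starProjection T‖ ^ 2 := by
  have hU' := mem_tensorSubspace_iff_sandwich.1 hU
  have h1 : compLeft Pᗮ.starProjection (T - U) = compLeft Pᗮ.starProjection T := by
    refine ext_toCLM fun x => ?_
    have : Pᗮ.starProjection (toCLM 𝕜 H H U x) = 0 :=
      (Submodule.starProjection_apply_eq_zero_iff _).2
        (P.le_orthogonal_orthogonal (apply_mem_of_mem_tensorSubspace hU x))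
    rw [compLeft_apply, compLeft_apply, map_sub, sub_apply, map_sub, this, sub_zero]
  have h2 : compRight (compLeft P.starProjection (T - U)) Q.starProjection =
      sandwich P Q T - U := by
    conv_rhs => rw [← hU']
    refine ext_toCLM fun x => ?_
    simp [compLeft_apply, compRight_apply, sandwich_apply]
  have h3 : compRight (compLeft P.starProjection (T - U)) Qᗮ.starProjection =
      compLeft P.starProjection (compRight T Qᗮ.starProjection) := by
    refine ext_toCLM fun x => ?_
    have h0 : Q.starProjection (Qᗮ.starProjection x) = 0 :=
      (Submodule.starProjection_apply_eq_zero_iff _).2 (Submodule.starProjection_apply_mem _ _)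
    have : toCLM 𝕜 H H U (Qᗮ.starProjection x) = 0 := by
      rw [← hU', sandwich_apply, h0, map_zero, map_zero]
    rw [compRight_apply, compLeft_apply, compLeft_apply, compRight_apply, map_sub,
      sub_apply, map_sub, this, map_zero, sub_zero]
  rw [norm_sq_eq_compLeft P, norm_sq_eq_compRight Q (compLeft P.starProjection (T - U)), h1, h2,
    h3]

/-- The orthogonal projection onto `P ⊗ Q` is `T ↦ π_P T π_Q`. -/
theorem starProjection_tensorSubspace [(tensorSubspace P Q).HasOrthogonalProjection]
    (T : HilbertSchmidt 𝕜 H H) :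
    (tensorSubspace P Q).starProjection T = sandwich P Q T := by
  have hmin : ‖T - (tensorSubspace P Q).starProjection T‖ ≤ ‖T - sandwich P Q T‖ := by
    rw [Submodule.starProjection_minimal]
    exact ciInf_le ⟨0, Set.forall_mem_range.2 fun _ => norm_nonneg _⟩
      (⟨_, sandwich_mem P Q T⟩ : tensorSubspace P Q)
  -- The two terms independent of `U` cancel, leaving `‖π_P T π_Q - proj T‖² ≤ 0`.
  have hsq := pow_le_pow_left₀ (norm_nonneg _) hmin 2
  rw [norm_sub_sq_of_mem_tensorSubspace P Q T (Submodule.starProjection_apply_mem _ T),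
    norm_sub_sq_of_mem_tensorSubspace P Q T (sandwich_mem P Q T), sub_self, norm_zero] at hsq
  have h0 : ‖sandwich P Q T - (tensorSubspace P Q).starProjection T‖ ^ 2 ≤ 0 := by linarith
  have h1 := pow_eq_zero_iff two_ne_zero |>.1 (le_antisymm h0 (by positivity))
  exact (sub_eq_zero.1 (norm_eq_zero.1 h1)).symm

theorem sandwich_rankOne (f g : H) :
    sandwich P Q (rankOne f g) = rankOne (P.starProjection f) (Q.starProjection g) := by
  refine ext_toCLM fun x => ?_
  rw [sandwich_apply, rankOne_apply, rankOne_apply, map_smul,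
    Submodule.inner_starProjection_left_eq_right]

variable {P Q} in
theorem rankOne_mem_tensorSubspace {f g : H} (hf : f ∈ P) (hg : g ∈ Q) :
    rankOne f g ∈ tensorSubspace P Q := by
  rw [mem_tensorSubspace_iff_sandwich, sandwich_rankOne,
    Submodule.starProjection_eq_self_iff.2 hf, Submodule.starProjection_eq_self_iff.2 hg]

end Projection

/-! ### Splitting bounds of products -/

section Split

variable {X Y : Type*} {P n : X → ℝ} {Q m : Y → ℝ}

/-- Take `B₁ = sup P/n` and `B₂ = B / B₁`. Whenever `Q y > 0`, every `P x / n x` is at most `B m y /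
Q y`; the point `y₀` makes the supremum finite, and passing to the supremum gives the bound on `Q
y`. Points with `n x = 0` contribute the quotient `0` and are covered by `hn0`. -/
theorem exists_upper_split {B : ℝ} (hn : ∀ x, 0 ≤ n x) (hm : ∀ y, 0 ≤ m y)
    (hn0 : ∀ x, n x = 0 → P x = 0) (hP0 : ∃ x, 0 < P x) (hQ0 : ∃ y, 0 < Q y)
    (h : ∀ x y, P x * Q y ≤ B * (n x * m y)) :
    ∃ B₁ B₂ : ℝ, 0 < B₁ ∧ 0 < B₂ ∧ (∀ x, P x ≤ B₁ * n x) ∧ (∀ y, Q y ≤ B₂ * m y) ∧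
      B = B₂ * B₁ := by
  obtain ⟨x₀, hx₀⟩ := hP0
  obtain ⟨y₀, hy₀⟩ := hQ0
  have hpos : ∀ {x}, 0 < P x → 0 < n x := fun {x} hx =>
    lt_of_le_of_ne (hn x) fun h0 => hx.ne' (hn0 x h0.symm)
  have hB : 0 < B := by
    by_contra hB
    have h1 := mul_nonneg (hn x₀) (hm y₀)
    nlinarith [h x₀ y₀, mul_pos hx₀ hy₀]
  have hbdd : BddAbove (Set.range fun x => P x / n x) := by
    refine ⟨B * m y₀ / Q y₀, Set.forall_mem_range.2 fun x => ?_⟩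
    have h0 : 0 ≤ B * m y₀ / Q y₀ := div_nonneg (mul_nonneg hB.le (hm _)) hy₀.le
    refine div_le_of_le_mul₀ (hn x) h0 ?_
    rw [div_mul_eq_mul_div, le_div_iff₀ hy₀]
    linarith [h x y₀]
  set B₁ := ⨆ x, P x / n x with hB₁
  have hle : ∀ x, P x ≤ B₁ * n x := fun x => by
    rcases (hn x).eq_or_lt with h0 | h0
    · rw [hn0 x h0.symm, ← h0, mul_zero]
    · exact (div_le_iff₀ h0).1 (le_ciSup hbdd x)
  have hB₁pos : 0 < B₁ := (div_pos hx₀ (hpos hx₀)).trans_le (le_ciSup hbdd x₀)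
  refine ⟨B₁, B / B₁, hB₁pos, div_pos hB hB₁pos, hle, fun y => ?_, by field_simp⟩
  rw [div_mul_eq_mul_div, le_div_iff₀ hB₁pos]
  rcases le_or_gt (Q y) 0 with hy | hy
  · exact (mul_nonpos_of_nonpos_of_nonneg hy hB₁pos.le).trans (mul_nonneg hB.le (hm y))
  · rw [mul_comm, ← le_div_iff₀ hy]
    have : Nonempty X := ⟨x₀⟩
    refine ciSup_le fun x => ?_
    have h0 : 0 ≤ B * m y / Q y := div_nonneg (mul_nonneg hB.le (hm _)) hy.le
    refine div_le_of_le_mul₀ (hn x) h0 ?_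
    rw [div_mul_eq_mul_div, le_div_iff₀ hy]
    linarith [h x y]

/-- Dually, `A₁ = inf P/n` and `A₂ = A / A₁`. The infimum runs only over `n x > 0`, since the
convention `P x / 0 = 0` would otherwise force it down to `0`. It is positive because `A m y₀ / Q
y₀` is a lower bound. -/
theorem exists_lower_split {A : ℝ} (hA : 0 < A) (hP : ∀ x, 0 ≤ P x) (hQ : ∀ y, 0 ≤ Q y)
    (hn : ∀ x, 0 ≤ n x) (hm : ∀ y, 0 ≤ m y)
    (hn0 : ∃ x, 0 < n x) (hm0 : ∃ y, 0 < m y) (h : ∀ x y, A * (n x * m y) ≤ P x * Q y) :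
    ∃ A₁ A₂ : ℝ, 0 < A₁ ∧ 0 < A₂ ∧ (∀ x, A₁ * n x ≤ P x) ∧ (∀ y, A₂ * m y ≤ Q y) ∧
      A = A₂ * A₁ := by
  obtain ⟨x₀, hx₀⟩ := hn0
  obtain ⟨y₀, hy₀⟩ := hm0
  have hQ₀ : 0 < Q y₀ := lt_of_le_of_ne (hQ y₀) fun h0 => by
    have h1 := h x₀ y₀
    rw [← h0, mul_zero] at h1
    exact absurd h1 (not_le.2 (by positivity))
  have : Nonempty {x // 0 < n x} := ⟨⟨x₀, hx₀⟩⟩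
  have hlow : ∀ {y}, 0 < Q y → ∀ x : {x // 0 < n x}, A * m y / Q y ≤ P x / n x := by
    intro y hy x
    rw [div_le_div_iff₀ hy x.2]
    linarith [h x y]
  have hbdd : BddBelow (Set.range fun x : {x // 0 < n x} => P x / n x) :=
    ⟨A * m y₀ / Q y₀, Set.forall_mem_range.2 fun x => hlow hQ₀ x⟩
  set A₁ := ⨅ x : {x // 0 < n x}, P x / n x with hA₁
  have hA₁pos : 0 < A₁ := (div_pos (mul_pos hA hy₀) hQ₀).trans_le (le_ciInf (hlow hQ₀))
  refine ⟨A₁, A / A₁, hA₁pos, div_pos hA hA₁pos, fun x => ?_, fun y => ?_, by field_simp⟩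
  · rcases (hn x).eq_or_lt with h0 | h0
    · rw [← h0, mul_zero]
      exact hP x
    · exact (le_div_iff₀ h0).1 (ciInf_le hbdd (⟨x, h0⟩ : {x // 0 < n x}))
  · rw [div_mul_eq_mul_div, div_le_iff₀ hA₁pos]
    rcases (hQ y).eq_or_lt with h0 | h0
    -- If `Q y = 0`, the inequality at `(x₀, y)` rules out `m y > 0`.
    · have h1 := h x₀ y
      rw [← h0, mul_zero] at h1
      rw [← h0, zero_mul]
      by_contra h2
      have : 0 < m y := by
        rcases (hm y).eq_or_lt with h3 | h3
        · rw [← h3, mul_zero] at h2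
          exact absurd le_rfl h2
        · exact h3
      exact absurd h1 (not_le.2 (by positivity))
    · rw [mul_comm (Q y), ← div_le_iff₀ h0]
      exact le_ciInf (hlow h0)

end Split

namespace FusionSystem

open HilbertSchmidt

variable {ι κ 𝕜 H : Type*} [RCLike 𝕜] [NormedAddCommGroup H] [InnerProductSpace 𝕜 H]
  [CompleteSpace H]

/-! ### Bessel fusion sequences and fusion frames -/

/-- The sum `∑ wᵢ² ‖π_{Wᵢ} f‖²` as an extended nonnegative real. -/
noncomputable def energy (W : FusionSystem ι 𝕜 H) (f : H) : ENNReal :=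
  ∑' i, ENNReal.ofReal (W.weight i ^ 2 * ‖(W.subspace i).starProjection f‖ ^ 2)

theorem energy_ne_top_iff {W : FusionSystem ι 𝕜 H} {f : H} : W.energy f ≠ ⊤ ↔
    Summable fun i => W.weight i ^ 2 * ‖(W.subspace i).starProjection f‖ ^ 2 :=
  (summable_iff fun _ => by positivity).symm

theorem ofReal_tsum_of_energy_ne_top {W : FusionSystem ι 𝕜 H} {f : H} (h : W.energy f ≠ ⊤) :
    ENNReal.ofReal (∑' i, W.weight i ^ 2 * ‖(W.subspace i).starProjection f‖ ^ 2) = W.energy f :=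
  ENNReal.ofReal_tsum_of_nonneg (fun _ => by positivity) (energy_ne_top_iff.1 h)

/-- A finite upper bound in `ENNReal` already contains summability, so sums can be exchanged freely
there. -/
theorem summable_and_tsum_le_iff {W : FusionSystem ι 𝕜 H} {f : H} {c : ℝ} (hc : 0 ≤ c) :
    ((Summable fun i => W.weight i ^ 2 * ‖(W.subspace i).starProjection f‖ ^ 2) ∧
      ∑' i, W.weight i ^ 2 * ‖(W.subspace i).starProjection f‖ ^ 2 ≤ c) ↔
    W.energy f ≤ ENNReal.ofReal c := by
  constructor
  · rintro ⟨hs, hle⟩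
    rw [← ofReal_tsum_of_energy_ne_top (energy_ne_top_iff.2 hs)]
    exact ENNReal.ofReal_le_ofReal hle
  · intro h
    have ht := ne_top_of_le_ne_top ENNReal.ofReal_ne_top h
    rw [← ofReal_tsum_of_energy_ne_top ht, ENNReal.ofReal_le_ofReal_iff hc] at h
    exact ⟨energy_ne_top_iff.1 ht, h⟩

theorem hasBesselBound_iff {W : FusionSystem ι 𝕜 H} {B : ℝ} :
    W.HasBesselBound B ↔
      0 < B ∧ ∀ f, W.energy f ≤ ENNReal.ofReal B * ENNReal.ofReal (‖f‖ ^ 2) := by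
  refine and_congr_right fun hB => forall_congr' fun f => ?_
  rw [summable_and_tsum_le_iff (by positivity), ENNReal.ofReal_mul hB.le]

theorem hasFrameBounds_iff {W : FusionSystem ι 𝕜 H} {A B : ℝ} :
    W.HasFrameBounds A B ↔ 0 < A ∧ A ≤ B ∧
      (∀ f, ENNReal.ofReal A * ENNReal.ofReal (‖f‖ ^ 2) ≤ W.energy f) ∧
      ∀ f, W.energy f ≤ ENNReal.ofReal B * ENNReal.ofReal (‖f‖ ^ 2) := by
  refine and_congr_right fun hA => and_congr_right fun hAB => ?_
  rw [← forall_and]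
  refine forall_congr' fun f => ?_
  have hB := hA.trans_le hAB
  rw [and_left_comm, summable_and_tsum_le_iff (by positivity), ENNReal.ofReal_mul hB.le]
  refine and_congr_left fun h => ?_
  have ht := ne_top_of_le_ne_top (ENNReal.mul_ne_top ENNReal.ofReal_ne_top ENNReal.ofReal_ne_top) h
  rw [← ofReal_tsum_of_energy_ne_top ht, ← ENNReal.ofReal_mul hA.le,
    ENNReal.ofReal_le_ofReal_iff (tsum_nonneg fun _ => by positivity)]

theorem HasFrameBounds.hasBesselBound {W : FusionSystem ι 𝕜 H} {A B : ℝ}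
    (h : W.HasFrameBounds A B) : W.HasBesselBound B :=
  ⟨h.1.trans_le h.2.1, fun f => ⟨(h.2.2 f).1, (h.2.2 f).2.2⟩⟩

/-- The energy of `T`, with the system applied to the values of `T`. -/
theorem tsum_compLeft_eq (W : FusionSystem ι 𝕜 H) (T : HilbertSchmidt 𝕜 H H) :
    ∑' j, ENNReal.ofReal (W.weight j ^ 2 * ‖compLeft (W.subspace j).starProjection T‖ ^ 2) =
      ∑' e, W.energy (toCLM 𝕜 H H T (stdBasis 𝕜 H e)) := by
  simp only [energy]
  rw [ENNReal.tsum_comm]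
  refine tsum_congr fun j => ?_
  rw [ENNReal.ofReal_mul (by positivity), ofReal_norm_sq (stdBasis 𝕜 H), ← ENNReal.tsum_mul_left]
  refine tsum_congr fun e => ?_
  rw [ENNReal.ofReal_mul (by positivity), compLeft_apply]

theorem starProjection_tensor (W : FusionSystem ι 𝕜 H) (V : FusionSystem κ 𝕜 H) (p : ι × κ)
    (T : HilbertSchmidt 𝕜 H H) : ((W.tensor V).subspace p).starProjection T =
      sandwich (W.subspace p.1) (V.subspace p.2) T :=
  have : (tensorSubspace (W.subspace p.1) (V.subspace p.2)).HasOrthogonalProjection :=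
    inferInstanceAs ((W.tensor V).subspace p).HasOrthogonalProjection
  starProjection_tensorSubspace _ _ T

/-- With `i` outermost, the inner sum is the operator energy of `W` at `T π_{V_i}`, ready for
`tsum_compLeft_eq`. -/
theorem energy_tensor (W : FusionSystem ι 𝕜 H) (V : FusionSystem κ 𝕜 H)
    (T : HilbertSchmidt 𝕜 H H) :
    (W.tensor V).energy T = ∑' i, ENNReal.ofReal (V.weight i ^ 2) *
      ∑' j, ENNReal.ofReal (W.weight j ^ 2 * ‖compLeft (W.subspace j).starProjection
        (compRight T (V.subspace i).starProjection)‖ ^ 2) := by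
  rw [energy, ← (Equiv.prodComm κ ι).tsum_eq, ENNReal.tsum_prod']
  refine tsum_congr fun i => ?_
  rw [← ENNReal.tsum_mul_left]
  refine tsum_congr fun j => ?_
  change ENNReal.ofReal ((V.weight i * W.weight j) ^ 2 *
    ‖((W.tensor V).subspace (j, i)).starProjection T‖ ^ 2) = _
  rw [← ENNReal.ofReal_mul (by positivity), ← mul_assoc, mul_pow (V.weight i),
    starProjection_tensor]
  rfl

theorem tsum_compRight_eq (V : FusionSystem κ 𝕜 H) (T : HilbertSchmidt 𝕜 H H) :
    ∑' i, ENNReal.ofReal (V.weight i ^ 2) *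
      ENNReal.ofReal (‖compRight T (V.subspace i).starProjection‖ ^ 2) =
    ∑' e, V.energy (toCLM 𝕜 H H (adjoint T) (stdBasis 𝕜 H e)) := by
  rw [← tsum_compLeft_eq]
  refine tsum_congr fun i => ?_
  rw [ENNReal.ofReal_mul (by positivity), norm_compRight_starProjection]

/-- The bound of `W` at each `T π_{V_i}` leaves `b ∑ v_i² ‖T π_{V_i}‖²`, which is `b` times the
energy of `V` summed over the vectors `T* e`. -/
theorem energy_tensor_le {W : FusionSystem ι 𝕜 H} {V : FusionSystem κ 𝕜 H} {b c : ENNReal}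
    (hW : ∀ f, W.energy f ≤ b * ENNReal.ofReal (‖f‖ ^ 2))
    (hV : ∀ f, V.energy f ≤ c * ENNReal.ofReal (‖f‖ ^ 2)) (T : HilbertSchmidt 𝕜 H H) :
    (W.tensor V).energy T ≤ c * b * ENNReal.ofReal (‖T‖ ^ 2) := by
  have hW' : ∀ S : HilbertSchmidt 𝕜 H H,
      ∑' e, W.energy (toCLM 𝕜 H H S (stdBasis 𝕜 H e)) ≤ b * ENNReal.ofReal (‖S‖ ^ 2) := fun S => by
    rw [ofReal_norm_sq (stdBasis 𝕜 H), ← ENNReal.tsum_mul_left]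
    exact ENNReal.tsum_le_tsum fun e => hW _
  have hV' : ∀ S : HilbertSchmidt 𝕜 H H,
      ∑' e, V.energy (toCLM 𝕜 H H S (stdBasis 𝕜 H e)) ≤ c * ENNReal.ofReal (‖S‖ ^ 2) := fun S => by
    rw [ofReal_norm_sq (stdBasis 𝕜 H), ← ENNReal.tsum_mul_left]
    exact ENNReal.tsum_le_tsum fun e => hV _
  calc (W.tensor V).energy T
      ≤ ∑' i, b * (ENNReal.ofReal (V.weight i ^ 2) *
          ENNReal.ofReal (‖compRight T (V.subspace i).starProjection‖ ^ 2)) := by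
        rw [energy_tensor]
        refine ENNReal.tsum_le_tsum fun i => ?_
        rw [tsum_compLeft_eq, mul_left_comm]
        exact mul_le_mul_right (hW' _) _
    _ ≤ b * (c * ENNReal.ofReal (‖adjoint T‖ ^ 2)) := by
        rw [ENNReal.tsum_mul_left, tsum_compRight_eq]
        exact mul_le_mul_right (hV' _) _
    _ = c * b * ENNReal.ofReal (‖T‖ ^ 2) := by rw [norm_adjoint]; ring

theorem le_energy_tensor {W : FusionSystem ι 𝕜 H} {V : FusionSystem κ 𝕜 H} {a c : ENNReal}
    (hW : ∀ f, a * ENNReal.ofReal (‖f‖ ^ 2) ≤ W.energy f)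
    (hV : ∀ f, c * ENNReal.ofReal (‖f‖ ^ 2) ≤ V.energy f) (T : HilbertSchmidt 𝕜 H H) :
    c * a * ENNReal.ofReal (‖T‖ ^ 2) ≤ (W.tensor V).energy T := by
  have hW' : ∀ S : HilbertSchmidt 𝕜 H H, a * ENNReal.ofReal (‖S‖ ^ 2) ≤
      ∑' e, W.energy (toCLM 𝕜 H H S (stdBasis 𝕜 H e)) := fun S => by
    rw [ofReal_norm_sq (stdBasis 𝕜 H), ← ENNReal.tsum_mul_left]
    exact ENNReal.tsum_le_tsum fun e => hW _
  have hV' : ∀ S : HilbertSchmidt 𝕜 H H, c * ENNReal.ofReal (‖S‖ ^ 2) ≤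
      ∑' e, V.energy (toCLM 𝕜 H H S (stdBasis 𝕜 H e)) := fun S => by
    rw [ofReal_norm_sq (stdBasis 𝕜 H), ← ENNReal.tsum_mul_left]
    exact ENNReal.tsum_le_tsum fun e => hV _
  calc c * a * ENNReal.ofReal (‖T‖ ^ 2) = a * (c * ENNReal.ofReal (‖adjoint T‖ ^ 2)) := by
        rw [norm_adjoint]; ring
    _ ≤ ∑' i, a * (ENNReal.ofReal (V.weight i ^ 2) *
          ENNReal.ofReal (‖compRight T (V.subspace i).starProjection‖ ^ 2)) := by
        rw [ENNReal.tsum_mul_left, tsum_compRight_eq]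
        exact mul_le_mul_right (hV' _) _
    _ ≤ (W.tensor V).energy T := by
        rw [energy_tensor]
        refine ENNReal.tsum_le_tsum fun i => ?_
        rw [tsum_compLeft_eq, mul_left_comm]
        exact mul_le_mul_right (hW' _) _

theorem HasBesselBound.tensor {W : FusionSystem ι 𝕜 H} {V : FusionSystem κ 𝕜 H} {b c : ℝ}
    (hW : W.HasBesselBound b) (hV : V.HasBesselBound c) :
    (W.tensor V).HasBesselBound (c * b) := by
  rw [hasBesselBound_iff] at *
  refine ⟨mul_pos hV.1 hW.1, fun T => ?_⟩
  rw [ENNReal.ofReal_mul hV.1.le]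
  exact energy_tensor_le hW.2 hV.2 T

theorem HasFrameBounds.tensor {W : FusionSystem ι 𝕜 H} {V : FusionSystem κ 𝕜 H}
    {a b a' b' : ℝ} (hW : W.HasFrameBounds a b) (hV : V.HasFrameBounds a' b') :
    (W.tensor V).HasFrameBounds (a' * a) (b' * b) := by
  rw [hasFrameBounds_iff] at *
  obtain ⟨ha, hab, hWl, hWu⟩ := hW
  obtain ⟨ha', hab', hVl, hVu⟩ := hV
  refine ⟨mul_pos ha' ha, mul_le_mul hab' hab ha.le (ha'.le.trans hab'), fun T => ?_, fun T => ?_⟩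
  · rw [ENNReal.ofReal_mul ha'.le]
    exact le_energy_tensor hWl hVl T
  · rw [ENNReal.ofReal_mul (ha'.le.trans hab')]
    exact energy_tensor_le hWu hVu T

/-- Projecting `f ⊗ g` gives `π_{W_j} f ⊗ π_{V_i} g`, so each term is a product. This is the source
of the converses for Bessel sequences and frames. -/
theorem energy_tensor_rankOne (W : FusionSystem ι 𝕜 H) (V : FusionSystem κ 𝕜 H) (f g : H) :
    (W.tensor V).energy (rankOne f g) = W.energy f * V.energy g := by
  rw [energy, ENNReal.tsum_prod', energy, ← ENNReal.tsum_mul_right]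
  refine tsum_congr fun j => ?_
  rw [energy, ← ENNReal.tsum_mul_left]
  refine tsum_congr fun i => ?_
  rw [← ENNReal.ofReal_mul (by positivity)]
  have h : ((W.tensor V).subspace (j, i)).starProjection (rankOne f g) =
      rankOne ((W.subspace j).starProjection f) ((V.subspace i).starProjection g) :=
    (starProjection_tensor W V (j, i) _).trans (sandwich_rankOne _ _ f g)
  rw [h, norm_rankOne]
  congr 1
  change (V.weight i * W.weight j) ^ 2 * _ = _
  ring

theorem energy_pos_of_mem {W : FusionSystem ι 𝕜 H} {j : ι} {f : H} (hf : f ∈ W.subspace j)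
    (hf0 : f ≠ 0) : 0 < W.energy f := by
  refine lt_of_lt_of_le ?_ (ENNReal.le_tsum j)
  rw [Submodule.starProjection_eq_self_iff.2 hf, ENNReal.ofReal_pos]
  have := W.weight_pos j
  have := norm_pos_iff.2 hf0
  positivity

theorem energy_zero (W : FusionSystem ι 𝕜 H) : W.energy 0 = 0 := by simp [energy]

theorem energy_mul_energy_le {W : FusionSystem ι 𝕜 H} {V : FusionSystem κ 𝕜 H} {B : ℝ}
    (h : (W.tensor V).HasBesselBound B) (f g : H) :
    W.energy f * V.energy g ≤ ENNReal.ofReal (B * (‖f‖ ^ 2 * ‖g‖ ^ 2)) := by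
  have h1 := (hasBesselBound_iff.1 h).2 (rankOne f g)
  rwa [energy_tensor_rankOne, norm_rankOne, ← ENNReal.ofReal_mul h.1.le, mul_pow] at h1

/-- A Bessel bound of `W ⊗ V` is a product of Bessel bounds, if neither system vanishes. -/
theorem HasBesselBound.exists_of_tensor {W : FusionSystem ι 𝕜 H} {V : FusionSystem κ 𝕜 H}
    {B : ℝ} (h : (W.tensor V).HasBesselBound B) (hW : ∃ f, 0 < W.energy f)
    (hV : ∃ g, 0 < V.energy g) :
    (∀ f, W.energy f ≠ ⊤) ∧ (∀ g, V.energy g ≠ ⊤) ∧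
      ∃ b c, W.HasBesselBound b ∧ V.HasBesselBound c ∧ B = c * b := by
  obtain ⟨f₀, hf₀⟩ := hW
  obtain ⟨g₀, hg₀⟩ := hV
  -- Infinite energy at `f` times the positive energy at `g₀` would be infinite, against the bound
  -- at `f ⊗ g₀`.
  have hWt : ∀ f, W.energy f ≠ ⊤ := fun f hf => by
    have h1 := energy_mul_energy_le h f g₀
    rw [hf, ENNReal.top_mul hg₀.ne'] at h1
    exact ENNReal.ofReal_ne_top (top_le_iff.1 h1)
  have hVt : ∀ g, V.energy g ≠ ⊤ := fun g hg => by
    have h1 := energy_mul_energy_le h f₀ g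
    rw [hg, ENNReal.mul_top hf₀.ne'] at h1
    exact ENNReal.ofReal_ne_top (top_le_iff.1 h1)
  obtain ⟨b, c, hb, hc, hPb, hQc, hB⟩ := exists_upper_split (B := B)
    (P := fun f => (W.energy f).toReal) (Q := fun g => (V.energy g).toReal)
    (n := fun f : H => ‖f‖ ^ 2) (m := fun g : H => ‖g‖ ^ 2) (fun _ => by positivity)
    (fun _ => by positivity)
    (fun f hf => by
      rw [pow_eq_zero_iff two_ne_zero, norm_eq_zero] at hf
      simp [hf, energy_zero])
    ⟨f₀, ENNReal.toReal_pos hf₀.ne' (hWt _)⟩ ⟨g₀, ENNReal.toReal_pos hg₀.ne' (hVt _)⟩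
    (fun f g => by
      have := h.1
      rw [← ENNReal.toReal_mul]
      exact ENNReal.toReal_le_of_le_ofReal (by positivity) (energy_mul_energy_le h f g))
  refine ⟨hWt, hVt, b, c, ?_, ?_, hB⟩
  · refine hasBesselBound_iff.2 ⟨hb, fun f => ?_⟩
    rw [← ENNReal.ofReal_mul hb.le]
    exact (ENNReal.le_ofReal_iff_toReal_le (hWt f) (by positivity)).2 (hPb f)
  · refine hasBesselBound_iff.2 ⟨hc, fun g => ?_⟩
    rw [← ENNReal.ofReal_mul hc.le]
    exact (ENNReal.le_ofReal_iff_toReal_le (hVt g) (by positivity)).2 (hQc g)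

theorem hasFrameBounds_of_subsingleton [Subsingleton H] (W : FusionSystem ι 𝕜 H) {A B : ℝ}
    (hA : 0 < A) (hAB : A ≤ B) : W.HasFrameBounds A B := by
  refine ⟨hA, hAB, fun f => ?_⟩
  simp [Subsingleton.elim f 0, summable_zero]

/-- The required `A ≤ B` comes from comparing both bounds at one nonzero vector. -/
theorem HasBesselBound.hasFrameBounds [Nontrivial H] {W : FusionSystem ι 𝕜 H} {A B : ℝ}
    (hB : W.HasBesselBound B) (hA : 0 < A) (ht : ∀ f, W.energy f ≠ ⊤)
    (hle : ∀ f, A * ‖f‖ ^ 2 ≤ (W.energy f).toReal) : W.HasFrameBounds A B := by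
  have hB0 := hB.1
  refine hasFrameBounds_iff.2 ⟨hA, ?_, fun f => ?_, (hasBesselBound_iff.1 hB).2⟩
  · obtain ⟨x, hx⟩ := exists_ne (0 : H)
    have hx' : 0 < ‖x‖ := norm_pos_iff.2 hx
    have h1 := (hasBesselBound_iff.1 hB).2 x
    rw [← ENNReal.ofReal_mul hB0.le] at h1
    have h2 := (hle x).trans (ENNReal.toReal_le_of_le_ofReal (by positivity) h1)
    exact le_of_mul_le_mul_right h2 (by positivity)
  · rw [← ENNReal.ofReal_mul hA.le, ENNReal.ofReal_le_iff_le_toReal (ht f)]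
    exact hle f

/-- Frame bounds of `W ⊗ V` are products of frame bounds. -/
theorem HasFrameBounds.exists_of_tensor {W : FusionSystem ι 𝕜 H} {V : FusionSystem κ 𝕜 H}
    {A B : ℝ} (h : (W.tensor V).HasFrameBounds A B) :
    ∃ a b a' b', W.HasFrameBounds a b ∧ V.HasFrameBounds a' b' ∧ A = a' * a ∧ B = b' * b := by
  -- If `H = 0`, all `0 < A ≤ B` are frame bounds, so `W` can take `A, B` and `V` can take `1, 1`.
  rcases subsingleton_or_nontrivial H with hH | hH
  · exact ⟨A, B, 1, 1, hasFrameBounds_of_subsingleton W h.1 h.2.1,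
      hasFrameBounds_of_subsingleton V one_pos le_rfl, (one_mul _).symm, (one_mul _).symm⟩
  obtain ⟨x, hx⟩ := exists_ne (0 : H)
  have hx' : 0 < ‖x‖ := norm_pos_iff.2 hx
  have hB := h.hasBesselBound
  obtain ⟨hA, hAB, hl, -⟩ := hasFrameBounds_iff.1 h
  have hl' : ∀ f g : H, ENNReal.ofReal (A * (‖f‖ ^ 2 * ‖g‖ ^ 2)) ≤ W.energy f * V.energy g :=
    fun f g => by
      have h1 := hl (rankOne f g)
      rwa [energy_tensor_rankOne, norm_rankOne, ← ENNReal.ofReal_mul hA.le, mul_pow] at h1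
  -- The lower frame bound at `x ⊗ x` makes both energies positive, so no hypothesis of nonzero
  -- subspaces is needed.
  have hpos : W.energy x * V.energy x ≠ 0 :=
    ((ENNReal.ofReal_pos.2 (by positivity)).trans_le (hl' x x)).ne'
  obtain ⟨hWt, hVt, b, b', hb, hb', hBB⟩ := hB.exists_of_tensor
    ⟨x, pos_iff_ne_zero.2 (left_ne_zero_of_mul hpos)⟩
    ⟨x, pos_iff_ne_zero.2 (right_ne_zero_of_mul hpos)⟩
  obtain ⟨a, a', ha, ha', hPa, hQa, hAA⟩ := exists_lower_split hA
    (P := fun f => (W.energy f).toReal) (Q := fun g => (V.energy g).toReal)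
    (n := fun f : H => ‖f‖ ^ 2) (m := fun g : H => ‖g‖ ^ 2) (fun _ => ENNReal.toReal_nonneg)
    (fun _ => ENNReal.toReal_nonneg) (fun _ => by positivity)
    (fun _ => by positivity) ⟨x, by positivity⟩ ⟨x, by positivity⟩
    (fun f g => by
      rw [← ENNReal.toReal_mul]
      exact (ENNReal.ofReal_le_iff_le_toReal (ENNReal.mul_ne_top (hWt f) (hVt g))).1 (hl' f g))
  refine ⟨a, b, a', b', hb.hasFrameBounds ha hWt hPa,
    hb'.hasFrameBounds ha' hVt hQa, hAA, hBB⟩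

/-! ### Fusion Riesz sequences -/

/-- Riesz bounds of `W` hold for Hilbert–Schmidt operators with values in the subspaces. -/
theorem HasRieszBounds.hilbertSchmidt {W : FusionSystem ι 𝕜 H} {A B : ℝ}
    (h : W.HasRieszBounds A B) (J : Finset ι) (X : ι → HilbertSchmidt 𝕜 H H)
    (hX : ∀ j x, toCLM 𝕜 H H (X j) x ∈ W.subspace j) :
    A * ∑ j ∈ J, ‖X j‖ ^ 2 ≤ ‖∑ j ∈ J, (W.weight j : 𝕜) • X j‖ ^ 2 ∧
      ‖∑ j ∈ J, (W.weight j : 𝕜) • X j‖ ^ 2 ≤ B * ∑ j ∈ J, ‖X j‖ ^ 2 := by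
  have h1 := hasSum_sum fun j (_ : j ∈ J) => hasSum_norm_sq (stdBasis 𝕜 H) (X j)
  have h2 := hasSum_norm_sq (stdBasis 𝕜 H) (∑ j ∈ J, (W.weight j : 𝕜) • X j)
  simp only [map_sum, map_smul, sum_apply, smul_apply] at h2
  -- The Riesz inequalities for the vectors `X j e`, to be summed over the basis vectors `e`.
  have h3 := fun e => h.2.2 J fun j => ⟨toCLM 𝕜 H H (X j) (stdBasis 𝕜 H e), hX j _⟩
  exact ⟨hasSum_le (fun e => (h3 e).1) (h1.mul_left A) h2,
    hasSum_le (fun e => (h3 e).2) h2 (h1.mul_left B)⟩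

theorem HasRieszBounds.hilbertSchmidt_adjoint {V : FusionSystem κ 𝕜 H} {A B : ℝ}
    (h : V.HasRieszBounds A B) (J : Finset κ) (X : κ → HilbertSchmidt 𝕜 H H)
    (hX : ∀ i x, toCLM 𝕜 H H (adjoint (X i)) x ∈ V.subspace i) :
    A * ∑ i ∈ J, ‖X i‖ ^ 2 ≤ ‖∑ i ∈ J, (V.weight i : 𝕜) • X i‖ ^ 2 ∧
      ‖∑ i ∈ J, (V.weight i : 𝕜) • X i‖ ^ 2 ≤ B * ∑ i ∈ J, ‖X i‖ ^ 2 := by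
  have h1 := h.hilbertSchmidt J (fun i => adjoint (X i)) hX
  rw [← adjoint_sum_smul] at h1
  simpa only [norm_adjoint] using h1

/-- Group the sum as `∑ w_j X_j` with `X_j = ∑ v_i Y_{ji}`. The `X_j` take values in `W_j`, so `W`
compares the total with `∑ ‖X_j‖²`; the adjoints of `Y_{ji}` take values in `V_i`, so `V` compares
each `‖X_j‖²` with `∑ ‖Y_{ji}‖²`. -/
theorem HasRieszBounds.tensor {W : FusionSystem ι 𝕜 H} {V : FusionSystem κ 𝕜 H}
    {a b a' b' : ℝ} (hW : W.HasRieszBounds a b) (hV : V.HasRieszBounds a' b') :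
    (W.tensor V).HasRieszBounds (a' * a) (b' * b) := by
  classical
  refine ⟨mul_pos hV.1 hW.1, mul_le_mul hV.2.1 hW.2.1 hW.1.le (hV.1.le.trans hV.2.1),
    fun J f => ?_⟩
  -- Extension by zero replaces the arbitrary finite set `J` by a rectangle, on which the sum can be
  -- grouped.
  set Y : ι → κ → HilbertSchmidt 𝕜 H H := fun j i =>
    if (j, i) ∈ J then (f (j, i) : HilbertSchmidt 𝕜 H H) else 0 with hY
  have hYmem : ∀ j i, Y j i ∈ tensorSubspace (W.subspace j) (V.subspace i) := fun j i => by
    rw [hY]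
    dsimp only
    split_ifs
    · exact (f (j, i)).2
    · exact Submodule.zero_mem _
  set J₁ := J.image Prod.fst
  set J₂ := J.image Prod.snd
  set X : ι → HilbertSchmidt 𝕜 H H := fun j => ∑ i ∈ J₂, (V.weight i : 𝕜) • Y j i with hX
  have hsub : J ⊆ J₁ ×ˢ J₂ := Finset.subset_product
  have hnorm : ∑ p ∈ J, ‖f p‖ ^ 2 = ∑ j ∈ J₁, ∑ i ∈ J₂, ‖Y j i‖ ^ 2 := by
    rw [← Finset.sum_product', ← Finset.sum_subset hsub fun p _ hp => by simp [hY, hp]]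
    refine Finset.sum_congr rfl fun p hp => ?_
    simp [hY, hp]
  have hsum : ∑ p ∈ J, ((W.tensor V).weight p : 𝕜) • (f p : HilbertSchmidt 𝕜 H H) =
      ∑ j ∈ J₁, (W.weight j : 𝕜) • X j := by
    simp only [hX, Finset.smul_sum, smul_smul]
    rw [← Finset.sum_product' (f := fun j i => ((W.weight j : 𝕜) * (V.weight i : 𝕜)) • Y j i),
      ← Finset.sum_subset hsub fun p _ hp => by simp [hY, hp]]
    refine Finset.sum_congr rfl fun p hp => ?_
    simp [hY, hp, FusionSystem.tensor, mul_comm]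
  have h1 := hW.hilbertSchmidt J₁ X fun j x => by
    simp only [hX, map_sum, map_smul, sum_apply, smul_apply]
    exact Submodule.sum_mem _ fun i _ =>
      Submodule.smul_mem _ _ (apply_mem_of_mem_tensorSubspace (hYmem j i) x)
  have h2 := fun j => hV.hilbertSchmidt_adjoint J₂ (Y j) fun i x =>
    apply_mem_of_mem_tensorSubspace (adjoint_mem_tensorSubspace (hYmem j i)) x
  rw [hnorm, hsum]
  constructor
  · refine le_trans ?_ h1.1
    rw [mul_comm a' a, mul_assoc, Finset.mul_sum (f := fun j => ∑ i ∈ J₂, ‖Y j i‖ ^ 2)]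
    exact mul_le_mul_of_nonneg_left (Finset.sum_le_sum fun j _ => (h2 j).1) hW.1.le
  · refine h1.2.trans ?_
    rw [mul_comm b' b, mul_assoc, Finset.mul_sum (f := fun j => ∑ i ∈ J₂, ‖Y j i‖ ^ 2)]
    exact mul_le_mul_of_nonneg_left (Finset.sum_le_sum fun j _ => (h2 j).2)
      (hW.1.le.trans hW.2.1)

omit [CompleteSpace H] in
theorem exists_sum_norm_sq_pos {W : FusionSystem ι 𝕜 H} (hW : ∃ j, W.subspace j ≠ ⊥) :
    ∃ x : Finset ι × (∀ j, W.subspace j), 0 < ∑ j ∈ x.1, ‖x.2 j‖ ^ 2 := by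
  classical
  obtain ⟨j, hj⟩ := hW
  obtain ⟨f, hf, hf0⟩ := Submodule.exists_mem_ne_zero_of_ne_bot hj
  refine ⟨({j}, Pi.single j ⟨f, hf⟩), ?_⟩
  have := norm_pos_iff.2 hf0
  simpa using pow_pos this 2

omit [CompleteSpace H] in
theorem norm_sum_sq_eq_zero (W : FusionSystem ι 𝕜 H) (J : Finset ι) (f : ∀ j, W.subspace j)
    (h : ∑ j ∈ J, ‖f j‖ ^ 2 = 0) : ‖∑ j ∈ J, (W.weight j : 𝕜) • (f j : H)‖ ^ 2 = 0 := by
  rw [Finset.sum_eq_zero_iff_of_nonneg fun _ _ => by positivity] at h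
  rw [Finset.sum_eq_zero fun j hj => ?_, norm_zero, zero_pow two_ne_zero]
  have h1 := h j hj
  rw [pow_eq_zero_iff two_ne_zero, norm_eq_zero] at h1
  rw [h1, ZeroMemClass.coe_zero, smul_zero]

/-- Riesz bounds of `W ⊗ V` are products of Riesz bounds, if neither system vanishes. -/
theorem HasRieszBounds.exists_of_tensor {W : FusionSystem ι 𝕜 H} {V : FusionSystem κ 𝕜 H}
    {A B : ℝ} (h : (W.tensor V).HasRieszBounds A B) (hW : ∃ j, W.subspace j ≠ ⊥)
    (hV : ∃ i, V.subspace i ≠ ⊥) :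
    ∃ a b a' b', W.HasRieszBounds a b ∧ V.HasRieszBounds a' b' ∧ A = a' * a ∧ B = b' * b := by
  -- A finite index set together with a family of vectors is one variable of the splitting lemmas.
  -- The test family is `f_j ⊗ g_i` on a rectangle, where both sides factor.
  have hprod : ∀ (x : Finset ι × (∀ j, W.subspace j)) (y : Finset κ × (∀ i, V.subspace i)),
      A * ((∑ j ∈ x.1, ‖x.2 j‖ ^ 2) * ∑ i ∈ y.1, ‖y.2 i‖ ^ 2) ≤
        ‖∑ j ∈ x.1, (W.weight j : 𝕜) • (x.2 j : H)‖ ^ 2 *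
          ‖∑ i ∈ y.1, (V.weight i : 𝕜) • (y.2 i : H)‖ ^ 2 ∧
      ‖∑ j ∈ x.1, (W.weight j : 𝕜) • (x.2 j : H)‖ ^ 2 *
          ‖∑ i ∈ y.1, (V.weight i : 𝕜) • (y.2 i : H)‖ ^ 2 ≤
        B * ((∑ j ∈ x.1, ‖x.2 j‖ ^ 2) * ∑ i ∈ y.1, ‖y.2 i‖ ^ 2) := by
    intro x y
    have h1 := h.2.2 (x.1 ×ˢ y.1) fun p =>
      ⟨rankOne (x.2 p.1 : H) (y.2 p.2 : H),
        rankOne_mem_tensorSubspace (x.2 p.1).2 (y.2 p.2).2⟩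
    have h2 : ∑ p ∈ x.1 ×ˢ y.1, ‖(rankOne (x.2 p.1 : H) (y.2 p.2 : H) :
        HilbertSchmidt 𝕜 H H)‖ ^ 2 = (∑ j ∈ x.1, ‖x.2 j‖ ^ 2) * ∑ i ∈ y.1, ‖y.2 i‖ ^ 2 := by
      rw [Finset.sum_mul_sum, Finset.sum_product]
      simp only [norm_rankOne, mul_pow, Submodule.coe_norm]
    have h3 := rankOne_sum_smul (𝕜 := 𝕜) x.1 y.1 W.weight V.weight
      (fun j => (x.2 j : H)) (fun i => (y.2 i : H))
    simp only [Submodule.coe_norm] at h1 h2 ⊢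
    rw [h2] at h1
    change _ ≤ ‖∑ p ∈ x.1 ×ˢ y.1, ((V.weight p.2 * W.weight p.1 : ℝ) : 𝕜) • (rankOne _ _ :
      HilbertSchmidt 𝕜 H H)‖ ^ 2 ∧ ‖∑ p ∈ x.1 ×ˢ y.1, ((V.weight p.2 * W.weight p.1 : ℝ) : 𝕜) •
        (rankOne _ _ : HilbertSchmidt 𝕜 H H)‖ ^ 2 ≤ _ at h1
    rwa [h3, norm_rankOne, mul_pow] at h1
  obtain ⟨x₀, hx₀⟩ := exists_sum_norm_sq_pos hW
  obtain ⟨y₀, hy₀⟩ := exists_sum_norm_sq_pos hV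
  -- The lower Riesz bound supplies the positive values of `P` and `Q` that the upper splitting
  -- needs.
  have hpos := (mul_pos h.1 (mul_pos hx₀ hy₀)).trans_le (hprod x₀ y₀).1
  obtain ⟨b, b', hb, hb', hPb, hQb, hBB⟩ := exists_upper_split
    (fun x : Finset ι × (∀ j, W.subspace j) => Finset.sum_nonneg fun j _ => by positivity)
    (fun y : Finset κ × (∀ i, V.subspace i) => Finset.sum_nonneg fun i _ => by positivity)
    (fun x => norm_sum_sq_eq_zero W x.1 x.2) ⟨x₀, pos_of_mul_pos_left hpos (by positivity)⟩
    ⟨y₀, pos_of_mul_pos_right hpos (by positivity)⟩ fun x y => (hprod x y).2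
  obtain ⟨a, a', ha, ha', hPa, hQa, hAA⟩ := exists_lower_split h.1
    (fun x : Finset ι × (∀ j, W.subspace j) => by positivity)
    (fun y : Finset κ × (∀ i, V.subspace i) => by positivity)
    (fun x => Finset.sum_nonneg fun j _ => by positivity)
    (fun y => Finset.sum_nonneg fun i _ => by positivity)
    ⟨x₀, hx₀⟩ ⟨y₀, hy₀⟩ fun x y => (hprod x y).1
  exact ⟨a, b, a', b',
    ⟨ha, le_of_mul_le_mul_right ((hPa x₀).trans (hPb x₀)) hx₀,
      fun J f => ⟨hPa (J, f), hPb (J, f)⟩⟩,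
    ⟨ha', le_of_mul_le_mul_right ((hQa y₀).trans (hQb y₀)) hy₀,
      fun J f => ⟨hQa (J, f), hQb (J, f)⟩⟩, hAA, hBB⟩

theorem exists_energy_pos {W : FusionSystem ι 𝕜 H} (hW : ∃ j, W.subspace j ≠ ⊥) :
    ∃ f, 0 < W.energy f := by
  obtain ⟨j, hj⟩ := hW
  obtain ⟨f, hf, hf0⟩ := Submodule.exists_mem_ne_zero_of_ne_bot hj
  exact ⟨f, energy_pos_of_mem hf hf0⟩

end FusionSystem

/-! ### The main theorem -/

theorem mainTheorem2 {ι κ 𝕜 H : Type*} [RCLike 𝕜] [NormedAddCommGroup H] [InnerProductSpace 𝕜 H]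
    [CompleteSpace H] (W : FusionSystem ι 𝕜 H) (V : FusionSystem κ 𝕜 H) :
    -- Bounds multiply.
    (∀ B_W B_V : ℝ, W.HasBesselBound B_W → V.HasBesselBound B_V →
      (W.tensor V).HasBesselBound (B_V * B_W)) ∧
    (∀ A_W B_W A_V B_V : ℝ, W.HasFrameBounds A_W B_W → V.HasFrameBounds A_V B_V →
      (W.tensor V).HasFrameBounds (A_V * A_W) (B_V * B_W)) ∧
    (∀ A_W B_W A_V B_V : ℝ, W.HasRieszBounds A_W B_W → V.HasRieszBounds A_V B_V →
      (W.tensor V).HasRieszBounds (A_V * A_W) (B_V * B_W)) ∧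
    -- Fusion frames: equivalence, and all bounds of the tensor system are products of bounds.
    (W.IsFrame ∧ V.IsFrame ↔ (W.tensor V).IsFrame) ∧
    (∀ A B : ℝ, (W.tensor V).HasFrameBounds A B →
      ∃ A_W B_W A_V B_V : ℝ, W.HasFrameBounds A_W B_W ∧ V.HasFrameBounds A_V B_V ∧
        A = A_V * A_W ∧ B = B_V * B_W) ∧
    -- The same for Bessel fusion sequences and fusion Riesz sequences, where both systems need a
    -- nonzero subspace (otherwise all `W_j ⊗ V_i` vanish).
    ((∃ j, W.subspace j ≠ ⊥) → (∃ i, V.subspace i ≠ ⊥) →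
      (W.IsBessel ∧ V.IsBessel ↔ (W.tensor V).IsBessel) ∧
      (∀ B : ℝ, (W.tensor V).HasBesselBound B →
        ∃ B_W B_V : ℝ, W.HasBesselBound B_W ∧ V.HasBesselBound B_V ∧ B = B_V * B_W) ∧
      (W.IsRieszSequence ∧ V.IsRieszSequence ↔ (W.tensor V).IsRieszSequence) ∧
      (∀ A B : ℝ, (W.tensor V).HasRieszBounds A B →
        ∃ A_W B_W A_V B_V : ℝ, W.HasRieszBounds A_W B_W ∧ V.HasRieszBounds A_V B_V ∧
          A = A_V * A_W ∧ B = B_V * B_W)) := by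
  refine ⟨fun _ _ hW hV => hW.tensor hV, fun _ _ _ _ hW hV => hW.tensor hV,
    fun _ _ _ _ hW hV => hW.tensor hV, ⟨?_, ?_⟩, fun _ _ h => h.exists_of_tensor,
    fun hW hV => ⟨⟨?_, ?_⟩, ?_, ⟨?_, ?_⟩, fun _ _ h => h.exists_of_tensor hW hV⟩⟩
  · rintro ⟨⟨_, _, hW⟩, _, _, hV⟩
    exact ⟨_, _, hW.tensor hV⟩
  · rintro ⟨_, _, h⟩
    obtain ⟨a, b, a', b', hW, hV, -⟩ := h.exists_of_tensor
    exact ⟨⟨a, b, hW⟩, a', b', hV⟩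
  · rintro ⟨⟨_, hW⟩, _, hV⟩
    exact ⟨_, hW.tensor hV⟩
  · rintro ⟨_, h⟩
    obtain ⟨-, -, b, c, hb, hc, -⟩ := h.exists_of_tensor (FusionSystem.exists_energy_pos hW)
      (FusionSystem.exists_energy_pos hV)
    exact ⟨⟨b, hb⟩, c, hc⟩
  · exact fun B h => (h.exists_of_tensor (FusionSystem.exists_energy_pos hW)
      (FusionSystem.exists_energy_pos hV)).2.2
  · rintro ⟨⟨_, _, hW⟩, _, _, hV⟩
    exact ⟨_, _, hW.tensor hV⟩
  · rintro ⟨_, _, h⟩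
    obtain ⟨a, b, a', b', hW, hV, -⟩ := h.exists_of_tensor hW hV
    exact ⟨⟨a, b, hW⟩, a', b', hV⟩
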